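/- For a positive integer $n$ let $G_{n,4/n}$ denote the binomial random graph on the vertex set $\{1,\dots,n\}$, in which each of the $\binom n2$ possible edges is present independently with probability $4/n$ (with probability $1$ for the irrelevant values $n<4$). Let $C_5$ be the cycle of length $5$; a homomorphism from a graph $G$ to $C_5$ is a map $V(G)\to V(C_5)$ that sends every edge of $G$ to an edge of $C_5$. Then with high probability $G_{n,4/n}$ has no homomorphism to $C_5$, that is, $$\lim_{n\to\infty}\Pr\bigl(\text{there is no homomorphism from } G_{n,4/n} \text{ to } C_5\bigr)=1 .$$ -/

import Mathlib

/-- The edge probability `c / n`, as an element of the unit interval. Values above `1`, which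
occur only for the finitely many `n < c`, are truncated to `1`. -/
noncomputable def edgeProb (c : ℝ) (n : ℕ) : unitInterval :=
  Set.projIcc (0 : ℝ) 1 zero_le_one (c / (n : ℝ))

/-! A homomorphism is a map f to the five-cycle whose pullback graph contains G. Let x be its class
densities, h their entropy and q the sum of x_i x_(i+1). The plain union bound has exponent n(h + 4q
- 2), positive at uniform x, because atypically sparse graphs dominate it. So graphs with fewer than
(99/50)n edges are discarded as unlikely, and the rest are bounded by Markov with weight 2^e(G). The
exponent per vertex becomes h + 8q - 2 - (99/50) log 2, which `entropy_add_five_cycle_form_le` makes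
negative on the whole simplex. By `sum_prod_density_le`, the union over maps costs h up to a
polynomial factor, without Stirling. -/

/-! ### Entropy against the quadratic form of the five-cycle -/

open Real in
theorem negMulLog_le_tangent {t l : ℝ} (ht : 0 ≤ t) (hl : 0 < l) :
    negMulLog t ≤ l - t - t * log l := by
  rcases ht.eq_or_lt with rfl | ht
  · simpa using hl.le
  have h := log_le_sub_one_of_pos (div_pos hl ht)
  rw [log_div hl.ne' ht.ne'] at h
  have h2 := mul_le_mul_of_nonneg_left h ht.le
  have h3 : t * (l / t - 1) = l - t := by field_simp
  rw [h3] at h2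
  unfold negMulLog
  linarith

theorem Real.log_half_pow (k : ℕ) : Real.log ((1 / 2 : ℝ) ^ k) = -(k * Real.log 2) := by
  rw [Real.log_pow, one_div, Real.log_inv]; ring

-- The coefficient of t^2 cancels the squares in four times `five_cycle_form_le_sq`. On each
-- interval below, a tangent to the entropy at 2^-k lies under this concave quadratic, which only
-- needs checking at the endpoints.
open Real in
theorem negMulLog_le_quadratic {t : ℝ} (h0 : 0 ≤ t) (h1 : t ≤ 11 / 20) :
    negMulLog t ≤ 17 / 200 + 91 / 50 * t - 62 / 25 * t ^ 2 := by
  have key (k : ℕ) : negMulLog t ≤ (1 / 2 : ℝ) ^ k - t + k * (t * log 2) := by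
    have := negMulLog_le_tangent h0 (l := (1 / 2 : ℝ) ^ k) (by positivity)
    rw [Real.log_half_pow] at this
    linarith
  have hl : t * log 2 ≤ t * 0.6931471808 := mul_le_mul_of_nonneg_left log_two_lt_d9.le h0
  rcases le_total t (9 / 100) with h | h
  · have := key 4
    norm_num at this hl
    nlinarith [mul_nonneg h0 (sub_nonneg.2 h)]
  rcases le_total t (1 / 5) with h' | h'
  · have := key 3
    norm_num at this hl
    nlinarith [mul_nonneg (sub_nonneg.2 h) (sub_nonneg.2 h')]
  rcases le_total t (2 / 5) with h'' | h''
  · have := key 2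
    norm_num at this hl
    nlinarith [mul_nonneg (sub_nonneg.2 h') (sub_nonneg.2 h'')]
  · have := key 1
    norm_num at this hl
    nlinarith [mul_nonneg (sub_nonneg.2 h'') (sub_nonneg.2 h1)]

/-- If d ≤ e, then cd ≤ ce bounds the form by (a + c + d)(b + e), and AM-GM finishes. Otherwise (a +
c + e)(b + d) serves. -/
theorem five_cycle_form_le_quarter {a b c d e : ℝ} (ha : 0 ≤ a) (hb : 0 ≤ b) (hc : 0 ≤ c)
    (hd : 0 ≤ d) (he : 0 ≤ e) :
    a * b + b * c + c * d + d * e + e * a ≤ (a + b + c + d + e) ^ 2 / 4 := by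
  rcases le_total d e with h | h
  · nlinarith [sq_nonneg (a - b + c + d - e), mul_nonneg hb hd, mul_nonneg hc (sub_nonneg.2 h)]
  · nlinarith [sq_nonneg (a - b + c - d + e), mul_nonneg hb he, mul_nonneg ha (sub_nonneg.2 h)]

/-- The adjacency matrix has eigenvalue 2 on constants and at most 2 cos(2π/5) < 31/50 on their
complement; 69/250 = (2 - 31/50)/5 gives equality on constants. The squares come from an LDLᵀ
factorization. -/
theorem five_cycle_form_le_sq (a b c d e : ℝ) :
    2 * (a * b + b * c + c * d + d * e + e * a) ≤
      31 / 50 * (a ^ 2 + b ^ 2 + c ^ 2 + d ^ 2 + e ^ 2) + 69 / 250 * (a + b + c + d + e) ^ 2 := by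
  linarith [mul_nonneg (show (0 : ℝ) ≤ 112 / 125 by norm_num)
      (sq_nonneg (a - 181 / 224 * b + 69 / 224 * c + 69 / 224 * d - 181 / 224 * e)),
    mul_nonneg (show (0 : ℝ) ≤ 3483 / 11200 by norm_num)
      (sq_nonneg (b - 5611 / 3483 * c + 69 / 43 * d - 3461 / 3483 * e)),
    mul_nonneg (show (0 : ℝ) ≤ 341 / 87075 by norm_num)
      (sq_nonneg (c - 81 / 62 * d + 19 / 62 * e)),
    mul_nonneg (show (0 : ℝ) ≤ 11 / 3100 by norm_num) (sq_nonneg (d - e))]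

open Real in
/-- On the simplex, entropy plus eight times the quadratic form of the five-cycle is bounded away
from `2 + 2 log 2`. -/
theorem entropy_add_five_cycle_form_le {x : Fin 5 → ℝ} (h0 : ∀ i, 0 ≤ x i) (h1 : ∑ i, x i = 1) :
    ∑ i, negMulLog (x i) + 8 * ∑ i, x i * x (i + 1) ≤ 2 + 2 * log 2 - 3 / 100 := by
  have hl := log_two_gt_d9
  norm_num at hl
  have hq : ∑ i, x i * x (i + 1) =
      x 0 * x 1 + x 1 * x 2 + x 2 * x 3 + x 3 * x 4 + x 4 * x 0 := by
    rw [Fin.sum_univ_five]; rfl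
  have h1' := h1
  rw [Fin.sum_univ_five] at h1'
  by_cases hx : ∀ i, x i ≤ 11 / 20
  · have h := Finset.sum_le_sum fun i (_ : i ∈ Finset.univ) ↦ negMulLog_le_quadratic (h0 i) (hx i)
    have h2 := five_cycle_form_le_sq (x 0) (x 1) (x 2) (x 3) (x 4)
    rw [h1'] at h2
    rw [Finset.sum_sub_distrib, Finset.sum_add_distrib, ← Finset.mul_sum, ← Finset.mul_sum, h1,
      Fin.sum_univ_five (fun i ↦ x i ^ 2)] at h
    simp only [Finset.sum_const, Finset.card_univ, Fintype.card_fin, nsmul_eq_mul] at h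
    norm_num at h
    rw [hq]
    linarith
  · push Not at hx
    obtain ⟨j, hj⟩ := hx
    have h2 := five_cycle_form_le_quarter (h0 0) (h0 1) (h0 2) (h0 3) (h0 4)
    rw [h1'] at h2
    have h (i : Fin 5) (k : ℕ) : negMulLog (x i) ≤ (1 / 2 : ℝ) ^ k - x i + k * (x i * log 2) := by
      have := negMulLog_le_tangent (h0 i) (l := (1 / 2 : ℝ) ^ k) (by positivity)
      rw [Real.log_half_pow] at this
      linarith
    -- Tangents at 1/2 for the large class and at 1/8 for the other four: these points sum to 1 and
    -- cancel the sum of the x i.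
    have hs := Finset.sum_le_sum fun i (_ : i ∈ Finset.univ) ↦ h i (if i = j then 1 else 3)
    have hsum : ∑ i, ((1 / 2 : ℝ) ^ (if i = j then 1 else 3) - x i +
        ((if i = j then 1 else 3 : ℕ) : ℝ) * (x i * log 2)) =
        (∑ i, (1 / 2 : ℝ) ^ (if i = j then 1 else 3) - ∑ i, x i) +
          (3 * ∑ i, x i - 2 * x j) * log 2 := by
      rw [Finset.sum_add_distrib, Finset.sum_sub_distrib, Finset.mul_sum, sub_mul, Finset.sum_mul,
        add_right_inj, eq_sub_iff_add_eq]
      have : 2 * x j * log 2 = ∑ i, if i = j then 2 * x i * log 2 else 0 := by simp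
      rw [this, ← Finset.sum_add_distrib]
      refine Finset.sum_congr rfl fun i _ ↦ ?_
      split_ifs <;> push_cast <;> ring
    have hhalf : ∑ i : Fin 5, (1 / 2 : ℝ) ^ (if i = j then 1 else 3) = 1 := by
      fin_cases j <;> simp [Fin.sum_univ_five] <;> norm_num
    rw [hsum, hhalf, h1] at hs
    have hjl : 11 / 20 * log 2 ≤ x j * log 2 :=
      mul_le_mul_of_nonneg_right hj.le (by linarith)
    rw [hq]
    linarith

/-! ### Counting maps by class sizes -/

/-- Summing over all maps `σ : V → ι` the product of the densities of the classes of the vertices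
gives at most the number of possible class-size vectors. -/
theorem sum_prod_density_le {V ι : Type*} [Fintype V] [Fintype ι] [DecidableEq V] [DecidableEq ι]
    [Nonempty V] :
    ∑ σ : V → ι, ∏ v, ((Finset.univ.filter fun w ↦ σ w = σ v).card / Fintype.card V : ℝ) ≤
      (Fintype.card V + 1 : ℝ) ^ Fintype.card ι := by
  set n := Fintype.card V with hn
  have hn0 : (n : ℝ) ≠ 0 := by simp [hn]
  let T : Finset (ι → ℕ) :=
    (Fintype.piFinset fun _ : ι ↦ Finset.range (n + 1)).filter fun k ↦ ∑ i, k i = n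
  let c (σ : V → ι) (i : ι) : ℕ := (Finset.univ.filter fun w ↦ σ w = i).card
  have hc (σ) : c σ ∈ T := by
    simp only [T, Finset.mem_filter, Fintype.mem_piFinset, Finset.mem_range, Nat.lt_succ_iff]
    refine ⟨fun i ↦ Finset.card_le_univ _, ?_⟩
    rw [hn, ← Finset.card_univ,
      Finset.card_eq_sum_card_fiberwise (f := σ) (t := Finset.univ) (by simp)]
  calc ∑ σ : V → ι, ∏ v, (c σ (σ v) / n : ℝ)
      ≤ ∑ σ : V → ι, ∑ k ∈ T, ∏ v, (k (σ v) / n : ℝ) :=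
        Finset.sum_le_sum fun σ _ ↦ Finset.single_le_sum (f := fun k ↦ ∏ v, (k (σ v) / n : ℝ))
          (fun k _ ↦ Finset.prod_nonneg fun v _ ↦ by positivity) (hc σ)
    _ = ∑ k ∈ T, 1 := by
        rw [Finset.sum_comm]
        refine Finset.sum_congr rfl fun k hk ↦ ?_
        have hk' : ∑ i, k i = n := (Finset.mem_filter.1 hk).2
        -- For fixed k the numbers k i / n form a probability vector, so the sum over all maps is a
        -- total mass, equal to 1.
        have := Finset.prod_univ_sum (fun _ : V ↦ (Finset.univ : Finset ι))
          (fun _ i ↦ (k i / n : ℝ))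
        rw [Fintype.piFinset_univ] at this
        rw [← this, ← Finset.sum_div, ← Nat.cast_sum, hk', div_self hn0, Finset.prod_const_one]
    _ ≤ (n + 1 : ℝ) ^ Fintype.card ι := by
        rw [Finset.sum_const, nsmul_eq_mul, mul_one]
        have : T.card ≤ (n + 1) ^ Fintype.card ι :=
          (Finset.card_filter_le _ _).trans (by simp [Fintype.card_piFinset])
        exact_mod_cast this

/-- The product of the densities of the classes of the vertices, in terms of entropy. -/
theorem prod_density_eq_exp_neg_entropy {V ι : Type*} [Fintype V] [Fintype ι] [DecidableEq V]
    [DecidableEq ι] [Nonempty V] (σ : V → ι) :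
    ∏ v, ((Finset.univ.filter fun w ↦ σ w = σ v).card / Fintype.card V : ℝ) =
      Real.exp (-(Fintype.card V * ∑ i, Real.negMulLog
        ((Finset.univ.filter fun w ↦ σ w = i).card / Fintype.card V))) := by
  have hn0 : (Fintype.card V : ℝ) ≠ 0 := by simp
  rw [Finset.mul_sum, ← Finset.sum_neg_distrib, Real.exp_sum]
  rw [← Finset.prod_fiberwise_of_maps_to (s := Finset.univ) (t := Finset.univ) (g := σ) (by simp)]
  refine Finset.prod_congr rfl fun i _ ↦ ?_
  rw [Finset.prod_congr rfl (g := fun _ ↦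
    ((Finset.univ.filter fun w ↦ σ w = i).card / Fintype.card V : ℝ))
    (fun v hv ↦ by rw [(Finset.mem_filter.1 hv).2]), Finset.prod_const]
  rcases Nat.eq_zero_or_pos (Finset.univ.filter fun w ↦ σ w = i).card with h | h
  -- An empty class contributes 0^0 = 1, matching `negMulLog 0 = 0`.
  · simp [h]
  · have hpos : (0 : ℝ) < (Finset.univ.filter fun w ↦ σ w = i).card := by exact_mod_cast h
    have hx : (0 : ℝ) < (Finset.univ.filter fun w ↦ σ w = i).card / Fintype.card V := by positivity
    rw [← Real.exp_log (pow_pos hx _), Real.log_pow, Real.negMulLog]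
    congr 1
    field_simp

/-! ### Exponential bounds for edge counts -/

namespace SimpleGraph

theorem measurableSingletonClass_of_countable {V : Type*} [Countable V] :
    MeasurableSingletonClass (SimpleGraph V) where
  measurableSet_singleton G := by
    have : {G} = edgeSet ⁻¹' {G.edgeSet} := by
      ext G'
      simp
    rw [this]
    exact measurable_edgeSet (MeasurableSet.singleton _)

open scoped Classical in
/-- The generating function of the number of edges of a binomial random graph contained in `H`. -/
theorem sum_pow_edgeCard_mul_binomialRandom_le {V : Type*} [Fintype V] (p : unitInterval)
    (H : SimpleGraph V) {y : ℝ} (hy : 0 ≤ y) :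
    ∑ G ∈ Finset.univ.filter (fun G : SimpleGraph V ↦ G ≤ H),
        y ^ G.edgeFinset.card * (binomialRandom V p).real {G} ≤
      Real.exp (p * y * H.edgeFinset.card - p * (Fintype.card V).choose 2) := by
  have hp0 : (0 : ℝ) ≤ p := p.2.1
  have hp1 : (0 : ℝ) ≤ 1 - p := sub_nonneg.2 p.2.2
  set N := (Fintype.card V).choose 2 with hN
  set g := H.edgeFinset.card with hg
  have hgN : g ≤ N := H.card_edgeFinset_le_card_choose_two
  have hsingle (G : SimpleGraph V) : (binomialRandom V p).real {G} =
      (p : ℝ) ^ G.edgeFinset.card * (1 - p : ℝ) ^ (N - G.edgeFinset.card) := by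
    rw [MeasureTheory.measureReal_def, binomialRandom_singleton, Nat.card_eq_fintype_card,
      ← coe_edgeFinset, Set.ncard_coe_finset]
    simp [hN]
  calc _ = ∑ G ∈ Finset.univ.filter (fun G : SimpleGraph V ↦ G ≤ H),
        (y * p) ^ G.edgeFinset.card * (1 - p : ℝ) ^ (N - G.edgeFinset.card) := by
        refine Finset.sum_congr rfl fun G _ ↦ ?_
        rw [hsingle, mul_pow, mul_assoc]
    _ = ∑ s ∈ (Finset.univ.filter (fun G : SimpleGraph V ↦ G ≤ H)).image (fun G ↦ G.edgeFinset),
        (y * p) ^ s.card * (1 - p : ℝ) ^ (N - s.card) := by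
        rw [Finset.sum_image]
        intro G _ G' _ h
        exact edgeFinset_inj.1 h
    _ ≤ ∑ s ∈ H.edgeFinset.powerset, (y * p) ^ s.card * (1 - p : ℝ) ^ (N - s.card) := by
        refine Finset.sum_le_sum_of_subset_of_nonneg ?_ fun s _ _ ↦ by positivity
        intro s hs
        obtain ⟨G, hG, rfl⟩ := Finset.mem_image.1 hs
        exact Finset.mem_powerset.2 (edgeFinset_subset_edgeFinset.2 (Finset.mem_filter.1 hG).2)
    _ = (1 - p : ℝ) ^ (N - g) * (y * p + (1 - p)) ^ g := by
        rw [hg, ← Finset.sum_pow_mul_eq_add_pow, Finset.mul_sum]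
        refine Finset.sum_congr rfl fun s hs ↦ ?_
        have hsg : s.card ≤ g := Finset.card_le_card (Finset.mem_powerset.1 hs)
        rw [mul_left_comm, ← pow_add]
        congr 2
        omega
    _ ≤ Real.exp (-p) ^ (N - g) * Real.exp (y * p - p) ^ g := by
        gcongr
        · linarith [Real.add_one_le_exp (-(p : ℝ))]
        · linarith [Real.add_one_le_exp (y * p - p : ℝ)]
    _ = Real.exp (p * y * g - p * N) := by
        rw [← Real.exp_nat_mul, ← Real.exp_nat_mul, ← Real.exp_add, Nat.cast_sub hgN]
        congr 1
        ring

open scoped Classical in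
/-- The probability that a binomial random graph is contained in `H` and has at least `m` edges. -/
theorem binomialRandom_le_and_edgeCard_ge {V : Type*} [Fintype V] (p : unitInterval)
    (H : SimpleGraph V) (m : ℝ) :
    (binomialRandom V p).real {G | G ≤ H ∧ m ≤ G.edgeFinset.card} ≤
      Real.exp (2 * p * H.edgeFinset.card - p * (Fintype.card V).choose 2 - m * Real.log 2) := by
  have := measurableSingletonClass_of_countable (V := V)
  have h := sum_pow_edgeCard_mul_binomialRandom_le p H zero_le_two
  calc (binomialRandom V p).real {G | G ≤ H ∧ m ≤ G.edgeFinset.card}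
      = ∑ G ∈ Finset.univ.filter (fun G : SimpleGraph V ↦ G ≤ H ∧ m ≤ G.edgeFinset.card),
        (binomialRandom V p).real {G} := by
        rw [MeasureTheory.sum_measureReal_singleton]
        simp
    _ ≤ ∑ G ∈ Finset.univ.filter (fun G : SimpleGraph V ↦ G ≤ H ∧ m ≤ G.edgeFinset.card),
        2 ^ G.edgeFinset.card * (binomialRandom V p).real {G} * Real.exp (-(m * Real.log 2)) := by
        refine Finset.sum_le_sum fun G hG ↦ ?_
        have hm := (Finset.mem_filter.1 hG).2.2
        have : (1 : ℝ) ≤ 2 ^ G.edgeFinset.card * Real.exp (-(m * Real.log 2)) := by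
          rw [← Real.rpow_natCast, Real.rpow_def_of_pos two_pos, ← Real.exp_add]
          refine Real.one_le_exp ?_
          nlinarith [Real.log_pos one_lt_two]
        rw [mul_right_comm]
        exact le_mul_of_one_le_left MeasureTheory.measureReal_nonneg this
    _ ≤ ∑ G ∈ Finset.univ.filter (fun G : SimpleGraph V ↦ G ≤ H),
        2 ^ G.edgeFinset.card * (binomialRandom V p).real {G} * Real.exp (-(m * Real.log 2)) := by
        refine Finset.sum_le_sum_of_subset_of_nonneg (fun G hG ↦ ?_) fun G _ _ ↦ by positivity
        simp only [Finset.mem_filter] at hG ⊢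
        exact ⟨hG.1, hG.2.1⟩
    _ ≤ _ := by
        rw [← Finset.sum_mul, sub_eq_add_neg _ (m * _), Real.exp_add]
        gcongr
        rwa [mul_comm 2 (p : ℝ)]

open scoped Classical in
/-- The lower tail of the number of edges of a binomial random graph. -/
theorem binomialRandom_edgeCard_lt {V : Type*} [Fintype V] (p : unitInterval) (m : ℝ) {d : ℝ}
    (h0 : 0 < d) (h1 : d < 1) :
    (binomialRandom V p).real {G | (G.edgeFinset.card : ℝ) < m} ≤
      Real.exp (-(p * d * (Fintype.card V).choose 2) - m * Real.log (1 - d)) := by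
  have hd : 0 < 1 - d := sub_pos.2 h1
  have h := sum_pow_edgeCard_mul_binomialRandom_le p (⊤ : SimpleGraph V) hd.le
  have := measurableSingletonClass_of_countable (V := V)
  have htop (_ : Fintype (⊤ : SimpleGraph V).edgeSet) :
      (⊤ : SimpleGraph V).edgeFinset.card = (Fintype.card V).choose 2 := by
    convert card_edgeFinset_top_eq_card_choose_two (V := V)
  rw [htop] at h
  calc (binomialRandom V p).real {G | (G.edgeFinset.card : ℝ) < m}
      = ∑ G ∈ Finset.univ.filter (fun G : SimpleGraph V ↦ (G.edgeFinset.card : ℝ) < m),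
        (binomialRandom V p).real {G} := by
        rw [MeasureTheory.sum_measureReal_singleton]
        simp
    _ ≤ ∑ G ∈ Finset.univ.filter (fun G : SimpleGraph V ↦ (G.edgeFinset.card : ℝ) < m),
        (1 - d) ^ G.edgeFinset.card * (binomialRandom V p).real {G} *
          Real.exp (-(m * Real.log (1 - d))) := by
        refine Finset.sum_le_sum fun G hG ↦ ?_
        have hm := (Finset.mem_filter.1 hG).2
        -- As log (1 - d) < 0, the weight is large on graphs with few edges.
        have : (1 : ℝ) ≤ (1 - d) ^ G.edgeFinset.card * Real.exp (-(m * Real.log (1 - d))) := by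
          rw [← Real.rpow_natCast, Real.rpow_def_of_pos hd, ← Real.exp_add]
          refine Real.one_le_exp ?_
          nlinarith [Real.log_neg hd (by linarith)]
        rw [mul_right_comm]
        exact le_mul_of_one_le_left MeasureTheory.measureReal_nonneg this
    _ ≤ ∑ G ∈ Finset.univ.filter (fun G : SimpleGraph V ↦ G ≤ ⊤),
        (1 - d) ^ G.edgeFinset.card * (binomialRandom V p).real {G} *
          Real.exp (-(m * Real.log (1 - d))) :=
        Finset.sum_le_sum_of_subset_of_nonneg (fun G _ ↦ by simp) fun G _ _ ↦ by positivity
    _ ≤ _ := by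
        rw [← Finset.sum_mul, sub_eq_add_neg _ (m * _), Real.exp_add]
        refine mul_le_mul_of_nonneg_right (h.trans_eq ?_) (Real.exp_nonneg _)
        congr 1
        ring

open scoped Classical in
/-- The number of edges of the pullback of the five-cycle, in terms of the class sizes. -/
theorem card_edgeFinset_comap_cycleGraph_five {V : Type*} [Fintype V] (f : V → Fin 5) :
    ((cycleGraph 5).comap f).edgeFinset.card =
      ∑ i, (Finset.univ.filter fun w ↦ f w = i).card *
        (Finset.univ.filter fun w ↦ f w = i + 1).card := by
  have hdeg (v : V) : ((cycleGraph 5).comap f).degree v =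
      (Finset.univ.filter fun w ↦ f w = f v + 1).card +
        (Finset.univ.filter fun w ↦ f w = f v - 1).card := by
    rw [← card_neighborFinset_eq_degree, ← Finset.card_union_of_disjoint]
    · congr 1
      ext w
      simp only [mem_neighborFinset, comap_adj, Finset.mem_union, Finset.mem_filter,
        Finset.mem_univ, true_and]
      generalize f v = i
      generalize f w = j
      revert i j
      decide
    · rw [Finset.disjoint_filter]
      intro w _
      generalize f v = i
      generalize f w = j
      revert i j
      decide
  have h := ((cycleGraph 5).comap f).sum_degrees_eq_twice_card_edges
  have hcls (F : Fin 5 → ℕ) :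
      ∑ v, F (f v) = ∑ i, (Finset.univ.filter fun w ↦ f w = i).card * F i := by
    rw [← Finset.sum_fiberwise_of_maps_to (s := Finset.univ) (t := Finset.univ) (g := f) (by simp)]
    refine Finset.sum_congr rfl fun i _ ↦ ?_
    rw [← smul_eq_mul, ← Finset.sum_const]
    exact Finset.sum_congr rfl fun v hv ↦ by rw [(Finset.mem_filter.1 hv).2]
  simp_rw [hdeg] at h
  rw [hcls fun i ↦ (Finset.univ.filter fun w ↦ f w = i + 1).card +
    (Finset.univ.filter fun w ↦ f w = i - 1).card] at h
  simp_rw [mul_add, Finset.sum_add_distrib] at h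
  -- The classes i - 1 and i + 1 contribute equally, so the degree sum is twice the claimed count.
  have hshift : ∑ i, (Finset.univ.filter fun w ↦ f w = i).card *
        (Finset.univ.filter fun w ↦ f w = i - 1).card =
      ∑ i, (Finset.univ.filter fun w ↦ f w = i).card *
        (Finset.univ.filter fun w ↦ f w = i + 1).card := by
    rw [← Equiv.sum_comp (Equiv.addRight (1 : Fin 5))]
    refine Finset.sum_congr rfl fun i _ ↦ ?_
    rw [Equiv.coe_addRight, add_sub_cancel_right, mul_comm]
  omega

end SimpleGraph

/-! ### Edge probability 4/n -/

theorem coe_edgeProb_four {n : ℕ} (hn : 4 ≤ n) : (edgeProb 4 n : ℝ) = 4 / n := by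
  have hn' : (4 : ℝ) ≤ n := by exact_mod_cast hn
  rw [edgeProb, Set.projIcc_of_mem zero_le_one (x := 4 / (n : ℝ))]
  exact ⟨by positivity, div_le_one_of_le₀ hn' (by positivity)⟩

theorem edgeProb_four_mul_choose_two {n : ℕ} (hn : 4 ≤ n) :
    (edgeProb 4 n : ℝ) * n.choose 2 = 2 * n - 2 := by
  have hn0 : (n : ℝ) ≠ 0 := by positivity
  rw [coe_edgeProb_four hn, Nat.cast_choose_two]
  field_simp
  ring

open scoped Classical in
theorem binomialRandom_four_edgeCard_lt {n : ℕ} (hn : 4 ≤ n) :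
    (SimpleGraph.binomialRandom (Fin n) (edgeProb 4 n)).real
        {G | (G.edgeFinset.card : ℝ) < 99 / 50 * n} ≤ Real.exp (1 - n / 20000) := by
  refine (SimpleGraph.binomialRandom_edgeCard_lt _ _ (d := 1 / 200) (by norm_num)
    (by norm_num)).trans (Real.exp_le_exp.2 ?_)
  -- This gives log (199/200) ≥ -1/199, and (99/50)/199 - 2/200 < -1/20000.
  have h := Real.one_sub_inv_le_log_of_pos (x := 1 - 1 / 200) (by norm_num)
  have h2 := mul_le_mul_of_nonneg_left h (show (0 : ℝ) ≤ 99 / 50 * n by positivity)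
  norm_num at h2 ⊢
  rw [mul_right_comm, edgeProb_four_mul_choose_two hn]
  have : (0 : ℝ) ≤ n := by positivity
  linarith

open scoped Classical in
theorem binomialRandom_four_le_comap_and_edgeCard_ge {n : ℕ} (hn : 4 ≤ n) (f : Fin n → Fin 5) :
    (SimpleGraph.binomialRandom (Fin n) (edgeProb 4 n)).real
        {G | G ≤ (SimpleGraph.cycleGraph 5).comap f ∧ 99 / 50 * n ≤ (G.edgeFinset.card : ℝ)} ≤
      (∏ v, ((Finset.univ.filter fun w ↦ f w = f v).card / Fintype.card (Fin n) : ℝ)) *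
        Real.exp (2 - n / 100) := by
  have hn0 : (n : ℝ) ≠ 0 := by positivity
  have : Nonempty (Fin n) := ⟨⟨0, by omega⟩⟩
  set x : Fin 5 → ℝ := fun i ↦ ((Finset.univ.filter fun w ↦ f w = i).card / n : ℝ) with hx
  have hx1 : ∑ i, x i = 1 := by
    rw [← Finset.sum_div, ← Nat.cast_sum, ← Finset.card_eq_sum_card_fiberwise (by simp)]
    simp [hn0]
  have hmain := mul_le_mul_of_nonneg_left
    (entropy_add_five_cycle_form_le (fun i ↦ (by positivity : 0 ≤ x i)) hx1) (Nat.cast_nonneg (α := ℝ) n)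
  have hedge (_ : Fintype ((SimpleGraph.cycleGraph 5).comap f).edgeSet) :
      2 * (edgeProb 4 n : ℝ) * ((SimpleGraph.cycleGraph 5).comap f).edgeFinset.card =
      8 * (n * ∑ i, x i * x (i + 1)) := by
    have hcard : ((SimpleGraph.cycleGraph 5).comap f).edgeFinset.card =
        ∑ i, (Finset.univ.filter fun w ↦ f w = i).card *
          (Finset.univ.filter fun w ↦ f w = i + 1).card := by
      convert SimpleGraph.card_edgeFinset_comap_cycleGraph_five f
    rw [hcard, coe_edgeProb_four hn, Nat.cast_sum,
      Finset.mul_sum, Finset.mul_sum, Finset.mul_sum]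
    refine Finset.sum_congr rfl fun i _ ↦ ?_
    simp only [hx]
    push_cast
    field_simp
    ring
  refine (SimpleGraph.binomialRandom_le_and_edgeCard_ge _ _ _).trans ?_
  rw [prod_density_eq_exp_neg_entropy, ← Real.exp_add, Real.exp_le_exp, hedge, Fintype.card_fin,
    edgeProb_four_mul_choose_two hn]
  change _ ≤ -(n * ∑ i, Real.negMulLog (x i)) + _
  -- Using 99/50 instead of 2 costs (1/50) log 2 ≤ 0.014 per vertex, within the entropy slack 3/100
  -- and leaving more than 1/100.
  have hlog : (n : ℝ) * Real.log 2 ≤ n * (7 / 10) :=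
    mul_le_mul_of_nonneg_left (by linarith [Real.log_two_lt_d9]) (by positivity)
  linarith

theorem binomialRandom_four_nonempty_hom_le {n : ℕ} (hn : 4 ≤ n) :
    (SimpleGraph.binomialRandom (Fin n) (edgeProb 4 n)).real
        {G | Nonempty (G →g SimpleGraph.cycleGraph 5)} ≤
      Real.exp (1 - n / 20000) + (n + 1) ^ 5 * Real.exp (2 - n / 100) := by
  classical
  have : Nonempty (Fin n) := ⟨⟨0, by omega⟩⟩
  set μ := SimpleGraph.binomialRandom (Fin n) (edgeProb 4 n)
  have hsub : {G | Nonempty (G →g SimpleGraph.cycleGraph 5)} ⊆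
      {G : SimpleGraph (Fin n) | (G.edgeFinset.card : ℝ) < 99 / 50 * n} ∪
        ⋃ f : Fin n → Fin 5, {G | G ≤ (SimpleGraph.cycleGraph 5).comap f ∧
          99 / 50 * n ≤ (G.edgeFinset.card : ℝ)} := by
    rintro G ⟨φ⟩
    rcases lt_or_ge (G.edgeFinset.card : ℝ) (99 / 50 * n) with h | h
    · exact Or.inl h
    · exact Or.inr (Set.mem_iUnion.2 ⟨φ, fun _ _ hab ↦ φ.map_adj hab, h⟩)
  refine (MeasureTheory.measureReal_mono hsub).trans
    ((MeasureTheory.measureReal_union_le _ _).trans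
      (add_le_add (binomialRandom_four_edgeCard_lt hn) ?_))
  refine (MeasureTheory.measureReal_iUnion_fintype_le _).trans ?_
  refine (Finset.sum_le_sum fun f _ ↦ binomialRandom_four_le_comap_and_edgeCard_ge hn f).trans ?_
  rw [← Finset.sum_mul]
  refine mul_le_mul_of_nonneg_right ?_ (Real.exp_nonneg _)
  simpa using sum_prod_density_le (V := Fin n) (ι := Fin 5)

theorem tendsto_exp_add_pow_mul_exp :
    Filter.Tendsto (fun n : ℕ ↦ Real.exp (1 - n / 20000) + (n + 1 : ℝ) ^ 5 * Real.exp (2 - n / 100))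
      Filter.atTop (nhds 0) := by
  have hcast := tendsto_natCast_atTop_atTop (R := ℝ)
  have h1 : Filter.Tendsto (fun n : ℕ ↦ Real.exp (1 - n / 20000)) Filter.atTop (nhds 0) := by
    refine Real.tendsto_exp_atBot.comp ?_
    simp only [sub_eq_add_neg]
    exact Filter.tendsto_atBot_add_const_left _ _
      (Filter.tendsto_neg_atTop_atBot.comp (hcast.atTop_div_const (by norm_num)))
  have h2 : Filter.Tendsto (fun n : ℕ ↦ (n + 1 : ℝ) ^ 5 * Real.exp (2 - n / 100))
      Filter.atTop (nhds 0) := by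
    have h := ((Real.tendsto_pow_mul_exp_neg_atTop_nhds_zero 5).comp
      ((Filter.tendsto_atTop_add_const_right _ (1 : ℝ) hcast).atTop_div_const
        (show (0 : ℝ) < 100 by norm_num))).const_mul (100 ^ 5 * Real.exp (2 + 1 / 100))
    rw [mul_zero] at h
    refine h.congr fun n ↦ ?_
    -- The power and the exponential now share the variable (n + 1) / 100.
    have : (2 - n / 100 : ℝ) = (2 + 1 / 100) + -((n + 1) / 100) := by ring
    simp only [Function.comp_apply]
    rw [this, Real.exp_add (2 + 1 / 100)]
    ring
  simpa using h1.add h2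

theorem theorem3 :
    Filter.Tendsto
      (fun n : ℕ => (SimpleGraph.binomialRandom (Fin n) (edgeProb 4 n))
        {G : SimpleGraph (Fin n) | IsEmpty (G →g SimpleGraph.cycleGraph 5)})
      Filter.atTop (nhds 1) := by
  have hreal : Filter.Tendsto (fun n : ℕ ↦
      (SimpleGraph.binomialRandom (Fin n) (edgeProb 4 n)).real
        {G | Nonempty (G →g SimpleGraph.cycleGraph 5)}) Filter.atTop (nhds 0) :=
    squeeze_zero' (.of_forall fun _ ↦ MeasureTheory.measureReal_nonneg)
      (Filter.eventually_atTop.2 ⟨4, fun _ hn ↦ binomialRandom_four_nonempty_hom_le hn⟩)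
      tendsto_exp_add_pow_mul_exp
  have h := ENNReal.tendsto_ofReal (hreal.const_sub 1)
  rw [sub_zero, ENNReal.ofReal_one] at h
  refine h.congr fun n ↦ ?_
  have := SimpleGraph.measurableSingletonClass_of_countable (V := Fin n)
  have hmeas : MeasurableSet {G : SimpleGraph (Fin n) |
      Nonempty (G →g SimpleGraph.cycleGraph 5)} := (Set.toFinite _).measurableSet
  rw [← MeasureTheory.probReal_compl_eq_one_sub hmeas, MeasureTheory.ofReal_measureReal]
  congr 1
  ext G
  simp
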